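/- Let $\lambda\ge 0$ and let either $r=1$ and $\beta\in(0,1)$, or $r=2$ and $\beta\in(0,2)$. Put $M_1=\chi_{[0,1]}$ and $M_2(x)=\int_0^1 M_1(x-t)\,dt$, the B-splines of order $1$ and $2$. Let $$B(p,v)=\frac{c_\beta}{2}\int_{\mathbb R}\int_{\mathbb R}\frac{(p(x)-p(y))(v(x)-v(y))}{e^{\lambda|x-y|}\,|x-y|^{1+\beta}}\,dy\,dx$$ be the bilinear form of the tempered fractional Laplacian $(\Delta+\lambda)^{\beta/2}$, where $$c_\beta=\frac{\beta\,\Gamma(\frac{1+\beta}{2})}{2^{1-\beta}\pi^{1/2}\Gamma(1-\beta/2)}\ \text{ if }\lambda=0\text{ or }\beta=1,\qquad c_\beta=\frac{\Gamma(\frac12)}{2\pi^{1/2}|\Gamma(-\beta)|}\ \text{ if }\lambda>0\text{ and }\beta\neq1.$$ For integers $n\ge n_0$, where $n_0$ is the least integer with $2^{n_0}\ge 2r$, let $\phi^r_{n,j}(x)=2^{n/2}M_r(2^nx-j)$ for $j=0,1,\dots,2^n-r$ (functions vanishing outside $[0,1]$), and let $\mathbf A=\mathbf A_n=\big(B(\phi^r_{n,i},\phi^r_{n,j})\big)_{i,j=0}^{2^n-r}$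 be the single-scale B-spline stiffness matrix. Then $\mathbf A_n$ is symmetric positive definite, and its spectral condition number $\mathrm{Cond}_2(\mathbf A_n)=\|\mathbf A_n\|_2\|\mathbf A_n^{-1}\|_2=\lambda_{\max}(\mathbf A_n)/\lambda_{\min}(\mathbf A_n)$ satisfies $\mathrm{Cond}_2(\mathbf A_n)\simeq 2^{n\beta}$: there are constants $0<c\le C<\infty$, depending only on $r,\beta,\lambda$, such that $$c\,2^{n\beta}\le \mathrm{Cond}_2(\mathbf A_n)\le C\,2^{n\beta}\qquad\text{for all } n\ge n_0 .$$ -/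

import Mathlib

open MeasureTheory

noncomputable section

namespace TemperedLaplacian

/-- The cardinal B-spline `M_m` of order `m ≥ 1`: `M_1` is the indicator function of `[0,1]` and
`M_{m+1}(x) = ∫₀¹ M_m(x - t) dt`. (There is no B-spline of order `0`; the value there is a dummy.) -/
def bspline : ℕ → ℝ → ℝ
  | 0 => fun _ => 0
  | 1 => Set.indicator (Set.Icc (0 : ℝ) 1) (fun _ => 1)
  | (m + 2) => fun x => ∫ t in (0 : ℝ)..1, bspline (m + 1) (x - t)

/-- The single-scale basis function `φ^r_{n,j}(x) = 2^{n/2} M_r(2^n x - j)`. -/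
def phi (r n j : ℕ) (x : ℝ) : ℝ :=
  (2 : ℝ) ^ ((n : ℝ) / 2) * bspline r ((2 : ℝ) ^ n * x - (j : ℝ))

open Classical in
/-- The normalising constant of the tempered fractional Laplacian `(Δ + lam)^{β/2}`. -/
def cConst (β lam : ℝ) : ℝ :=
  if lam = 0 ∨ β = 1 then
    β * Real.Gamma ((1 + β) / 2)
      / ((2 : ℝ) ^ (1 - β) * Real.pi ^ ((1 : ℝ) / 2) * Real.Gamma (1 - β / 2))
  else
    Real.Gamma (1 / 2) / (2 * Real.pi ^ ((1 : ℝ) / 2) * |Real.Gamma (-β)|)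

/-- The bilinear form `B(p,v)` of the weak formulation of the tempered fractional Laplacian. -/
def bilin (β lam : ℝ) (p v : ℝ → ℝ) : ℝ :=
  cConst β lam / 2 *
    ∫ x : ℝ, ∫ y : ℝ,
      ((p x - p y) * (v x - v y)) / (Real.exp (lam * |x - y|) * |x - y| ^ (1 + β))

/-- The stiffness matrix `A = B(Φ_n^r, Φ_n^r)`, indexed by `{0, 1, …, 2^n - r}`. -/
def stiffness (β lam : ℝ) (r n : ℕ) : Matrix (Fin (2 ^ n - r + 1)) (Fin (2 ^ n - r + 1)) ℝ :=
  Matrix.of fun i j => bilin β lam (phi r n i) (phi r n j)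

/-- The spectral norm of a real square matrix: the operator norm induced by the Euclidean norm. -/
def specNorm {N : ℕ} (A : Matrix (Fin N) (Fin N) ℝ) : ℝ :=
  ‖Matrix.toEuclideanCLM (n := Fin N) (𝕜 := ℝ) A‖

/-- The spectral condition number `‖A‖₂ ‖A⁻¹‖₂` (meaningful for invertible `A`). -/
def cond2 {N : ℕ} (A : Matrix (Fin N) (Fin N) ℝ) : ℝ :=
  specNorm A * specNorm A⁻¹

end TemperedLaplacian

end

noncomputable section

/-! Up to the positive factor `cConst β lam / 2`, the quadratic form of the stiffness matrix at c is
the Gagliardo energy of u = ∑ c_j φ_j (`dotProduct_stiffness_mulVec`). Its Rayleigh quotient lies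
between a constant and a constant times 2^{nβ}, and both orders are reached.

Upper end: for each pair (x, y) at most four basis functions differ between x and y, so the energy
of u is at most 4 ∑ c_j² times the energies of the single φ_j (`energy_sum_le`). By dilation each of
these is 2^{nβ} times the energy of the generator with tempering lam/2^n (`energy_scaledSpline`),
finite because β < r. A diagonal entry of A gives the matching lower bound for ‖A‖.

Lower end: u vanishes outside [0,1), so the pairs in [0,1] × [2,3] alone bound the energy below by a
constant times ∫u² (`le_energy`), and L² stability bounds ∫u² below by |c|²/4
(`sum_sq_div_four_le_integral`). This is sharp: by the two-scale relation the coarsest basis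
function lies in every spline space (`exists_sum_scaledSpline_eq`), with fixed energy and
coefficients of norm bounded below, so ‖A⁻¹‖ cannot tend to 0. -/

namespace TemperedLaplacian

/-! ### Spectral norms from Rayleigh quotients -/

section SpectralNorm

variable {N : ℕ} {A : Matrix (Fin N) (Fin N) ℝ}

open Matrix in
theorem inner_toEuclideanCLM_eq (A : Matrix (Fin N) (Fin N) ℝ) (x : EuclideanSpace ℝ (Fin N)) :
    inner ℝ x (toEuclideanCLM (n := Fin N) (𝕜 := ℝ) A x) = x.ofLp ⬝ᵥ A *ᵥ x.ofLp := by
  rw [inner_toEuclideanCLM]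

theorem norm_sq_eq_dotProduct (x : EuclideanSpace ℝ (Fin N)) :
    ‖x‖ ^ 2 = x.ofLp ⬝ᵥ x.ofLp := by
  rw [EuclideanSpace.norm_sq_eq]
  simp [dotProduct, sq]

open Matrix in
theorem posDef_of_le_dotProduct {m : ℝ} (hA : A.IsSymm) (hm : 0 < m)
    (h : ∀ x : Fin N → ℝ, m * (x ⬝ᵥ x) ≤ x ⬝ᵥ A *ᵥ x) : A.PosDef := by
  refine PosDef.of_dotProduct_mulVec_pos ?_ fun x hx => ?_
  · rwa [IsHermitian, conjTranspose_eq_transpose_of_trivial]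
  · have h1 : 0 < x ⬝ᵥ x := by
      have := (dotProduct_star_self_pos_iff (v := x)).2 hx
      simpa using this
    simpa using (mul_pos hm h1).trans_le (h x)

/-- The Cauchy–Schwarz inequality for a positive semidefinite operator. -/
theorem inner_sq_le_of_nonneg {E : Type*} [NormedAddCommGroup E] [InnerProductSpace ℝ E]
    (T : E →L[ℝ] E) (hT : ∀ x y, inner ℝ (T x) y = inner ℝ x (T y))
    (hpos : ∀ x, 0 ≤ inner ℝ x (T x)) (x y : E) :
    inner ℝ x (T y) ^ 2 ≤ inner ℝ x (T x) * inner ℝ y (T y) := by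
  have h : ∀ t : ℝ, 0 ≤ inner ℝ y (T y) * (t * t) + 2 * inner ℝ x (T y) * t
      + inner ℝ x (T x) := by
    intro t
    have := hpos (x + t • y)
    have h2 : inner ℝ y (T x) = inner ℝ x (T y) := by rw [← hT, real_inner_comm]
    simp only [map_add, map_smul, inner_add_left, inner_add_right, inner_smul_left,
      inner_smul_right, h2] at this
    simp only [conj_trivial] at this
    linarith
  have := discrim_le_zero h
  rw [discrim] at this
  nlinarith

open Matrix in
theorem toEuclideanCLM_symm (hA : A.IsSymm) (x y : EuclideanSpace ℝ (Fin N)) :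
    inner ℝ (toEuclideanCLM (n := Fin N) (𝕜 := ℝ) A x) y
      = inner ℝ x (toEuclideanCLM (n := Fin N) (𝕜 := ℝ) A y) := by
  rw [real_inner_comm, inner_toEuclideanCLM, inner_toEuclideanCLM, dotProduct_mulVec,
    ← mulVec_transpose, hA.eq, dotProduct_comm]

-- Cauchy–Schwarz for the form of A at the pair (Ax, x) gives ‖Ax‖⁴ ≤ ⟨Ax, A(Ax)⟩⟨x, Ax⟩ ≤
-- M²‖Ax‖²‖x‖²; no eigenvalues are needed.
open Matrix in
theorem specNorm_le_of_dotProduct_le {M : ℝ} (hA : A.IsSymm) (hM : 0 ≤ M)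
    (h0 : ∀ x : Fin N → ℝ, 0 ≤ x ⬝ᵥ A *ᵥ x)
    (h : ∀ x : Fin N → ℝ, x ⬝ᵥ A *ᵥ x ≤ M * (x ⬝ᵥ x)) : specNorm A ≤ M := by
  refine ContinuousLinearMap.opNorm_le_bound _ hM fun x => ?_
  set T := toEuclideanCLM (n := Fin N) (𝕜 := ℝ) A
  have hq : ∀ z, inner ℝ z (T z) ≤ M * ‖z‖ ^ 2 := fun z => by
    rw [norm_sq_eq_dotProduct, inner_toEuclideanCLM_eq]; exact h _
  have hn : ∀ z, 0 ≤ inner ℝ z (T z) := fun z => by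
    rw [inner_toEuclideanCLM_eq]; exact h0 _
  have hcs := inner_sq_le_of_nonneg T (toEuclideanCLM_symm hA) hn (T x) x
  rw [real_inner_self_eq_norm_sq] at hcs
  have h1 : (‖T x‖ ^ 2) ^ 2 ≤ (M * ‖T x‖ ^ 2) * (M * ‖x‖ ^ 2) :=
    hcs.trans (mul_le_mul (hq _) (hq _) (hn _) (by positivity))
  rcases (norm_nonneg (T x)).eq_or_lt with h2 | h2
  · rw [← h2]; positivity
  · refine abs_le_of_sq_le_sq' ?_ (by positivity) |>.2
    have : 0 < ‖T x‖ ^ 2 := by positivity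
    refine le_of_mul_le_mul_left ?_ this
    nlinarith

open Matrix in
theorem diag_le_specNorm (A : Matrix (Fin N) (Fin N) ℝ) (i : Fin N) : A i i ≤ specNorm A := by
  set T := toEuclideanCLM (n := Fin N) (𝕜 := ℝ) A with hT
  have h : inner ℝ (EuclideanSpace.single i (1 : ℝ)) (T (EuclideanSpace.single i 1)) = A i i := by
    rw [hT, inner_toEuclideanCLM_eq]
    simp
  rw [← h]
  refine (real_inner_le_norm _ _).trans ?_
  have := T.le_opNorm (EuclideanSpace.single i (1 : ℝ))
  rw [specNorm, ← hT]
  simpa using this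

open Matrix in
theorem toEuclideanCLM_apply_inv (hA : A.PosDef) (x : EuclideanSpace ℝ (Fin N)) :
    toEuclideanCLM (n := Fin N) (𝕜 := ℝ) A (toEuclideanCLM (n := Fin N) (𝕜 := ℝ) A⁻¹ x) = x := by
  have h : A * A⁻¹ = 1 := mul_nonsing_inv _ ((isUnit_iff_isUnit_det _).1 hA.isUnit)
  rw [← mul_apply_eq_comp, ← map_mul, h, map_one, one_apply_eq_self]

open Matrix in
theorem specNorm_inv_le {m : ℝ} (hA : A.PosDef) (hm : 0 < m)
    (h : ∀ x : Fin N → ℝ, m * (x ⬝ᵥ x) ≤ x ⬝ᵥ A *ᵥ x) : specNorm A⁻¹ ≤ m⁻¹ := by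
  refine ContinuousLinearMap.opNorm_le_bound _ (by positivity) fun x => ?_
  set y := toEuclideanCLM (n := Fin N) (𝕜 := ℝ) A⁻¹ x with hy
  have h1 : toEuclideanCLM (n := Fin N) (𝕜 := ℝ) A y = x := toEuclideanCLM_apply_inv hA x
  have h2 : m * ‖y‖ ^ 2 ≤ ‖y‖ * ‖x‖ := by
    refine le_trans ?_ (real_inner_le_norm _ _)
    rw [norm_sq_eq_dotProduct]
    refine (h y.ofLp).trans_eq ?_
    rw [← inner_toEuclideanCLM_eq, h1]
  rw [inv_mul_eq_div, le_div_iff₀ hm]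
  rcases (norm_nonneg y).eq_or_lt with h3 | h3
  · rw [← h3]; simp
  · refine le_of_mul_le_mul_left ?_ h3
    nlinarith

-- Cauchy–Schwarz for the form of A at the pair (x, A⁻¹x) gives ‖x‖⁴ ≤ ⟨x, Ax⟩⟨A⁻¹x, x⟩, so a single
-- test vector with small Rayleigh quotient forces ‖A⁻¹‖ to be large.
open Matrix in
theorem inv_le_specNorm_inv {K : ℝ} (hA : A.PosDef) (hK : 0 < K) {x : Fin N → ℝ}
    (hx : 0 < x ⬝ᵥ x) (h : x ⬝ᵥ A *ᵥ x ≤ K * (x ⬝ᵥ x)) : K⁻¹ ≤ specNorm A⁻¹ := by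
  have hsymm : A.IsSymm := by
    have := hA.isHermitian
    rwa [IsHermitian, conjTranspose_eq_transpose_of_trivial] at this
  set T := toEuclideanCLM (n := Fin N) (𝕜 := ℝ) A
  set S := toEuclideanCLM (n := Fin N) (𝕜 := ℝ) A⁻¹ with hS
  set v : EuclideanSpace ℝ (Fin N) := WithLp.toLp 2 x with hv
  have hvx : ‖v‖ ^ 2 = x ⬝ᵥ x := norm_sq_eq_dotProduct v
  have hTS : T (S v) = v := toEuclideanCLM_apply_inv hA v
  have hn : ∀ z, 0 ≤ inner ℝ z (T z) := fun z => by
    rw [inner_toEuclideanCLM_eq]; simpa using hA.posSemidef.dotProduct_mulVec_nonneg z.ofLp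
  have hcs := inner_sq_le_of_nonneg T (toEuclideanCLM_symm hsymm) hn v (S v)
  rw [hTS, real_inner_self_eq_norm_sq] at hcs
  have h1 : inner ℝ v (T v) ≤ K * ‖v‖ ^ 2 := by
    rw [hvx, inner_toEuclideanCLM_eq]; exact h
  have h2 : inner ℝ (S v) v ≤ specNorm A⁻¹ * ‖v‖ ^ 2 := by
    refine (real_inner_le_norm _ _).trans ?_
    have := mul_le_mul_of_nonneg_right (S.le_opNorm v) (norm_nonneg v)
    rw [specNorm, ← hS]
    linarith
  rw [← hvx] at hx
  have h3 : (‖v‖ ^ 2) ^ 2 ≤ (K * ‖v‖ ^ 2) * (specNorm A⁻¹ * ‖v‖ ^ 2) := by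
    refine hcs.trans (mul_le_mul h1 h2 ?_ (by positivity))
    have := hn (S v)
    rwa [hTS] at this
  rw [inv_eq_one_div, div_le_iff₀ hK]
  have h4 : 0 < (‖v‖ ^ 2) ^ 2 := by positivity
  refine le_of_mul_le_mul_left ?_ h4
  nlinarith

end SpectralNorm

/-! ### Pointwise models of the B-splines -/

/-- A pointwise model of the B-splines of order `1` and `2`: the indicator of `[0,1)` and the hat
function on `[0,2]`. -/
def spline (r : ℕ) (x : ℝ) : ℝ :=
  if r = 1 then Set.indicator (Set.Ico (0 : ℝ) 1) (fun _ => 1) x else max 0 (1 - |x - 1|)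

/-- The basis functions built from `spline`. -/
def scaledSpline (r n j : ℕ) (x : ℝ) : ℝ :=
  (2 : ℝ) ^ ((n : ℝ) / 2) * spline r ((2 : ℝ) ^ n * x - (j : ℝ))

theorem spline_one (x : ℝ) : spline 1 x = Set.indicator (Set.Ico (0 : ℝ) 1) (fun _ => 1) x := by
  simp [spline]

theorem spline_two (x : ℝ) : spline 2 x = max 0 (1 - |x - 1|) := by
  simp [spline]

theorem measurable_spline (r : ℕ) : Measurable (spline r) := by
  unfold spline
  split_ifs
  · exact measurable_const.indicator measurableSet_Ico
  · fun_prop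

theorem measurable_scaledSpline (r n j : ℕ) : Measurable (scaledSpline r n j) := by
  unfold scaledSpline
  exact ((measurable_spline r).comp (by fun_prop)).const_mul _

theorem spline_nonneg (r : ℕ) (x : ℝ) : 0 ≤ spline r x := by
  unfold spline
  split_ifs
  · exact Set.indicator_nonneg (fun _ _ => zero_le_one) _
  · exact le_max_left _ _

theorem spline_le_one (r : ℕ) (x : ℝ) : spline r x ≤ 1 := by
  unfold spline
  split_ifs
  · exact Set.indicator_le_self' (fun _ _ => zero_le_one) _
  · exact max_le zero_le_one (by linarith [abs_nonneg (x - 1)])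

theorem spline_eq_zero {r : ℕ} (hr : r = 1 ∨ r = 2) {x : ℝ} (hx : x < 0 ∨ r ≤ x) :
    spline r x = 0 := by
  rcases hr with rfl | rfl
  · rw [spline_one]
    refine Set.indicator_of_notMem (fun h => ?_) _
    rcases hx with hx | hx
    · exact absurd h.1 (not_le.2 hx)
    · exact absurd h.2 (not_lt.2 (by simpa using hx))
  · rw [spline_two]
    refine max_eq_left ?_
    rcases hx with hx | hx
    · linarith [neg_le_abs (x - 1)]
    · push_cast at hx
      linarith [le_abs_self (x - 1)]

theorem self_le_spline {r : ℕ} {x : ℝ} (hx : x ∈ Set.Ico (0 : ℝ) 1) : x ≤ spline r x := by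
  unfold spline
  split_ifs
  · rw [Set.indicator_of_mem hx]; exact hx.2.le
  · refine le_max_of_le_right ?_
    rw [abs_of_neg (by linarith [hx.2])]
    linarith

theorem bspline_two_eq (x : ℝ) : bspline 2 x = spline 2 x := by
  have h1 : bspline 2 x = ∫ t in (0 : ℝ)..1, bspline 1 (x - t) := rfl
  rw [h1, intervalIntegral.integral_comp_sub_left (fun t => bspline 1 t), spline_two,
    intervalIntegral.integral_of_le (by linarith)]
  simp only [bspline]
  rw [setIntegral_indicator measurableSet_Icc, setIntegral_const, smul_eq_mul, mul_one]
  -- The convolution of two unit indicators is the length of the overlap of [x-1, x] with [0, 1].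
  have h2 : volume.real (Set.Ioc (x - 1) (x - 0) ∩ Set.Icc 0 1)
      = volume.real (Set.Icc (max (x - 1) 0) (min x 1)) := by
    refine measureReal_congr ?_
    have h3 : (Set.Ioc (x - 1) (x - 0) ∩ Set.Icc 0 1 : Set ℝ)
        =ᵐ[volume] (Set.Icc (x - 1) (x - 0) ∩ Set.Icc 0 1 : Set ℝ) :=
      Ioc_ae_eq_Icc.inter (Filter.EventuallyEq.refl _ _)
    rw [Set.Icc_inter_Icc] at h3
    simpa using h3
  rw [h2, Real.volume_real_Icc]
  rcases le_total x 1 with h | h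
  · rw [max_eq_right (by linarith : x - 1 ≤ 0), min_eq_left h, abs_of_nonpos (by linarith),
      max_comm]
    ring_nf
  · rw [max_eq_left (by linarith : 0 ≤ x - 1), min_eq_right h, abs_of_nonneg (by linarith),
      max_comm]

theorem bspline_ae_eq {r : ℕ} (hr : r = 1 ∨ r = 2) : bspline r =ᵐ[volume] spline r := by
  rcases hr with rfl | rfl
  · have : spline 1 = Set.indicator (Set.Ico (0 : ℝ) 1) (fun _ => 1) := funext spline_one
    rw [this, bspline]
    exact indicator_ae_eq_of_ae_eq_set Ico_ae_eq_Icc.symm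
  · exact Filter.Eventually.of_forall bspline_two_eq

/-- The affine change of variable pulls null sets back to null sets. -/
theorem phi_ae_eq {r : ℕ} (hr : r = 1 ∨ r = 2) (n j : ℕ) :
    phi r n j =ᵐ[volume] scaledSpline r n j := by
  have hq : Measure.QuasiMeasurePreserving (fun x : ℝ => (2 : ℝ) ^ n * x - (j : ℝ)) := by
    refine ⟨by fun_prop, ?_⟩
    have h1 : (fun x : ℝ => (2 : ℝ) ^ n * x - (j : ℝ))
        = (fun x => x - (j : ℝ)) ∘ (fun x => (2 : ℝ) ^ n * x) := rfl
    rw [h1, ← Measure.map_map (by fun_prop) (by fun_prop),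
      Real.map_volume_mul_left (by positivity), Measure.map_smul,
      (measurePreserving_sub_right volume (j : ℝ)).map_eq]
    exact Measure.smul_absolutelyContinuous
  filter_upwards [hq.ae_eq (bspline_ae_eq hr)] with x hx
  simp only [Function.comp] at hx
  simp only [phi, scaledSpline, hx]

/-! ### Finite overlap of the supports -/

/-- Cauchy–Schwarz over the nonzero terms only: the constant is the overlap number, independent of
the dimension. -/
theorem sq_sum_mul_le {ι : Type*} [Fintype ι] (c a : ι → ℝ) {k : ℕ} (S : Finset ι)
    (hS : ∀ i, i ∉ S → a i = 0) (hk : S.card ≤ k) :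
    (∑ i, c i * a i) ^ 2 ≤ k * ∑ i, c i ^ 2 * a i ^ 2 := by
  have h1 : ∑ i, c i * a i = ∑ i ∈ S, c i * a i :=
    (Finset.sum_subset (Finset.subset_univ S) fun i _ hi => by rw [hS i hi, mul_zero]).symm
  have h2 : ∑ i, c i ^ 2 * a i ^ 2 = ∑ i ∈ S, (c i * a i) ^ 2 := by
    rw [← Finset.sum_subset (Finset.subset_univ S) fun i _ hi => by rw [hS i hi]; ring]
    exact Finset.sum_congr rfl fun i _ => by ring
  rw [h1, h2]
  refine sq_sum_le_card_mul_sum_sq.trans ?_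
  gcongr

theorem exists_finset_scaledSpline_eq_zero {r : ℕ} (hr : r = 1 ∨ r = 2) (n N : ℕ) (x : ℝ) :
    ∃ S : Finset (Fin N), S.card ≤ 2 ∧ ∀ j, j ∉ S → scaledSpline r n j x = 0 := by
  classical
  set z : ℝ := (2 : ℝ) ^ n * x
  refine ⟨Finset.univ.filter fun j : Fin N => ((j : ℕ) : ℤ) ∈ Finset.Icc (⌊z⌋ - 1) ⌊z⌋, ?_, ?_⟩
  · calc _ ≤ (Finset.Icc (⌊z⌋ - 1) ⌊z⌋).card :=
          Finset.card_le_card_of_injOn (fun j : Fin N => ((j : ℕ) : ℤ))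
            (fun j hj => (Finset.mem_filter.1 hj).2)
            (fun i _ j _ hij => Fin.ext (Nat.cast_injective hij))
      _ = 2 := by rw [Int.card_Icc]; omega
  · intro j hj
    have hj' : ¬ ((⌊z⌋ - 1 ≤ ((j : ℕ) : ℤ)) ∧ ((j : ℕ) : ℤ) ≤ ⌊z⌋) := by simpa using hj
    have : spline r (z - (j : ℕ)) = 0 := by
      refine spline_eq_zero hr ?_
      by_contra! h
      apply hj'
      have hr2 : (r : ℝ) ≤ 2 := by rcases hr with rfl | rfl <;> norm_num
      constructor
      · have h1 : z < (((j : ℕ) : ℤ) : ℝ) + 2 := by push_cast; linarith [h.2]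
        have : ⌊z⌋ < ((j : ℕ) : ℤ) + 2 := Int.floor_lt.2 (by push_cast at h1 ⊢; exact h1)
        omega
      · exact Int.le_floor.2 (by push_cast; linarith [h.1])
    simp only [scaledSpline]
    rw [this, mul_zero]

theorem sq_sum_scaledSpline_le {r : ℕ} (hr : r = 1 ∨ r = 2) (n : ℕ) {N : ℕ} (c : Fin N → ℝ)
    (x : ℝ) :
    (∑ j, c j * scaledSpline r n j x) ^ 2 ≤ 2 * ∑ j, c j ^ 2 * scaledSpline r n j x ^ 2 := by
  obtain ⟨S, hS, h⟩ := exists_finset_scaledSpline_eq_zero hr n N x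
  exact_mod_cast sq_sum_mul_le c (fun j => scaledSpline r n j x) S h hS

theorem sq_sum_scaledSpline_sub_le {r : ℕ} (hr : r = 1 ∨ r = 2) (n : ℕ) {N : ℕ} (c : Fin N → ℝ)
    (x y : ℝ) :
    (∑ j, c j * (scaledSpline r n j x - scaledSpline r n j y)) ^ 2
      ≤ 4 * ∑ j, c j ^ 2 * (scaledSpline r n j x - scaledSpline r n j y) ^ 2 := by
  classical
  obtain ⟨S, hS, h⟩ := exists_finset_scaledSpline_eq_zero hr n N x
  obtain ⟨T, hT, h'⟩ := exists_finset_scaledSpline_eq_zero hr n N y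
  refine (sq_sum_mul_le c (fun j => scaledSpline r n j x - scaledSpline r n j y) (S ∪ T)
    (fun j hj => ?_) ((Finset.card_union_le S T).trans (add_le_add hS hT))).trans (by norm_num)
  rw [Finset.notMem_union] at hj
  rw [h j hj.1, h' j hj.2, sub_zero]

/-! ### Two-scale relations and nestedness of the spline spaces -/

theorem spline_two_of_mem_left {x : ℝ} (h0 : 0 ≤ x) (h1 : x ≤ 1) : spline 2 x = x := by
  rw [spline_two, abs_of_nonpos (by linarith), max_eq_right (by linarith)]
  ring

theorem spline_two_of_mem_right {x : ℝ} (h1 : 1 ≤ x) (h2 : x ≤ 2) : spline 2 x = 2 - x := by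
  rw [spline_two, abs_of_nonneg (by linarith), max_eq_right (by linarith)]
  ring

theorem spline_two_of_nonpos {x : ℝ} (h : x ≤ 0) : spline 2 x = 0 := by
  rw [spline_two, abs_of_nonpos (by linarith), max_eq_left (by linarith)]

theorem spline_two_of_two_le {x : ℝ} (h : 2 ≤ x) : spline 2 x = 0 := by
  rw [spline_two, abs_of_nonneg (by linarith), max_eq_left (by linarith)]

theorem spline_one_of_mem {x : ℝ} (h0 : 0 ≤ x) (h1 : x < 1) : spline 1 x = 1 := by
  rw [spline_one]
  exact Set.indicator_of_mem (Set.mem_Ico.2 ⟨h0, h1⟩) _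

/-- This holds at every point thanks to the half-open interval; the closed indicator would count z =
1/2 twice. -/
theorem spline_one_two_scale (z : ℝ) : spline 1 z = spline 1 (2 * z) + spline 1 (2 * z - 1) := by
  have hz : ∀ {x : ℝ}, x < 0 ∨ 1 ≤ x → spline 1 x = 0 := fun h =>
    spline_eq_zero (Or.inl rfl) (by simpa using h)
  rcases lt_or_ge z 0 with h | h
  · rw [hz (Or.inl h), hz (Or.inl (by linarith)), hz (Or.inl (by linarith)), add_zero]
  rcases lt_or_ge z (1 / 2) with h' | h'
  · rw [spline_one_of_mem h (by linarith), spline_one_of_mem (by linarith) (by linarith),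
      hz (Or.inl (by linarith)), add_zero]
  rcases lt_or_ge z 1 with h'' | h''
  · rw [spline_one_of_mem h h'', hz (Or.inr (by linarith)),
      spline_one_of_mem (by linarith) (by linarith), zero_add]
  · rw [hz (Or.inr h''), hz (Or.inr (by linarith)), hz (Or.inr (by linarith)), add_zero]

theorem spline_two_two_scale (z : ℝ) :
    spline 2 z = 1 / 2 * spline 2 (2 * z) + spline 2 (2 * z - 1) + 1 / 2 * spline 2 (2 * z - 2) := by
  rcases le_total z 0 with h | h
  · rw [spline_two_of_nonpos h, spline_two_of_nonpos (by linarith),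
      spline_two_of_nonpos (by linarith), spline_two_of_nonpos (by linarith)]
    ring
  rcases le_total z (1 / 2) with h' | h'
  · rw [spline_two_of_mem_left h (by linarith), spline_two_of_mem_left (by linarith) (by linarith),
      spline_two_of_nonpos (by linarith), spline_two_of_nonpos (by linarith)]
    ring
  rcases le_total z 1 with h1 | h1
  · rw [spline_two_of_mem_left h h1, spline_two_of_mem_right (by linarith) (by linarith),
      spline_two_of_mem_left (by linarith) (by linarith), spline_two_of_nonpos (by linarith)]
    ring
  rcases le_total z (3 / 2) with h2 | h2
  · rw [spline_two_of_mem_right h1 (by linarith), spline_two_of_two_le (by linarith),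
      spline_two_of_mem_right (by linarith) (by linarith),
      spline_two_of_mem_left (by linarith) (by linarith)]
    ring
  rcases le_total z 2 with h3 | h3
  · rw [spline_two_of_mem_right h1 h3, spline_two_of_two_le (by linarith),
      spline_two_of_two_le (by linarith), spline_two_of_mem_right (by linarith) (by linarith)]
    ring
  · rw [spline_two_of_two_le h3, spline_two_of_two_le (by linarith),
      spline_two_of_two_le (by linarith), spline_two_of_two_le (by linarith)]
    ring

/-- The two-scale relation: each basis function is a combination of those on the next level. -/
theorem scaledSpline_mem_span_succ {r : ℕ} (hr : r = 1 ∨ r = 2) {n : ℕ} (hn : r ≤ 2 ^ n)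
    {j : ℕ} (hj : j < 2 ^ n - r + 1) :
    scaledSpline r n j ∈ Submodule.span ℝ
      (Set.range fun i : Fin (2 ^ (n + 1) - r + 1) => scaledSpline r (n + 1) i) := by
  have hmem : ∀ i : ℕ, i < 2 ^ (n + 1) - r + 1 → scaledSpline r (n + 1) i ∈ Submodule.span ℝ
      (Set.range fun i : Fin (2 ^ (n + 1) - r + 1) => scaledSpline r (n + 1) i) :=
    fun i hi => Submodule.subset_span ⟨⟨i, hi⟩, rfl⟩
  have h2 : 2 ^ (n + 1) = 2 * 2 ^ n := by ring
  -- The ratio of the normalising factors of the two levels; its value plays no role.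
  obtain ⟨s, hs⟩ : ∃ s : ℝ, (2 : ℝ) ^ ((n : ℝ) / 2) = s * (2 : ℝ) ^ (((n + 1 : ℕ) : ℝ) / 2) :=
    ⟨(2 : ℝ) ^ ((n : ℝ) / 2) / (2 : ℝ) ^ (((n + 1 : ℕ) : ℝ) / 2), by field_simp⟩
  have hz : ∀ x : ℝ, (2 : ℝ) ^ (n + 1) * x = 2 * ((2 : ℝ) ^ n * x) := fun x => by ring
  rcases hr with rfl | rfl
  · have : scaledSpline 1 n j
        = s • (scaledSpline 1 (n + 1) (2 * j) + scaledSpline 1 (n + 1) (2 * j + 1)) := by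
      funext x
      simp only [Pi.smul_apply, Pi.add_apply, smul_eq_mul, scaledSpline, hs, hz]
      push_cast
      set z := (2 : ℝ) ^ n * x - j with hz'
      have e1 : 2 * ((2 : ℝ) ^ n * x) - 2 * (j : ℝ) = 2 * z := by rw [hz']; ring
      have e2 : 2 * ((2 : ℝ) ^ n * x) - (2 * (j : ℝ) + 1) = 2 * z - 1 := by rw [hz']; ring
      rw [e1, e2, spline_one_two_scale]
      ring
    rw [this]
    exact Submodule.smul_mem _ _ (Submodule.add_mem _ (hmem _ (by omega)) (hmem _ (by omega)))
  · have : scaledSpline 2 n j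
        = s • ((1 / 2 : ℝ) • scaledSpline 2 (n + 1) (2 * j) + scaledSpline 2 (n + 1) (2 * j + 1)
          + (1 / 2 : ℝ) • scaledSpline 2 (n + 1) (2 * j + 2)) := by
      funext x
      simp only [Pi.smul_apply, Pi.add_apply, smul_eq_mul, scaledSpline, hs, hz]
      push_cast
      set z := (2 : ℝ) ^ n * x - j with hz'
      have e1 : 2 * ((2 : ℝ) ^ n * x) - 2 * (j : ℝ) = 2 * z := by rw [hz']; ring
      have e2 : 2 * ((2 : ℝ) ^ n * x) - (2 * (j : ℝ) + 1) = 2 * z - 1 := by rw [hz']; ring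
      have e3 : 2 * ((2 : ℝ) ^ n * x) - (2 * (j : ℝ) + 2) = 2 * z - 2 := by rw [hz']; ring
      rw [e1, e2, e3, spline_two_two_scale]
      ring
    rw [this]
    exact Submodule.smul_mem _ _ (Submodule.add_mem _ (Submodule.add_mem _
      (Submodule.smul_mem _ _ (hmem _ (by omega))) (hmem _ (by omega)))
      (Submodule.smul_mem _ _ (hmem _ (by omega))))

/-- The coarsest basis function lies in the spline space of every level. -/
theorem exists_sum_scaledSpline_eq {r : ℕ} (hr : r = 1 ∨ r = 2) {n : ℕ} (hn : r ≤ 2 ^ n) :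
    ∃ c : Fin (2 ^ n - r + 1) → ℝ, ∀ x,
      ∑ j, c j * scaledSpline r n j x = scaledSpline r (r - 1) 0 x := by
  have hle : r - 1 ≤ n := by
    rcases hr with rfl | rfl
    · simp
    · by_contra! h
      interval_cases n
      simp at hn
  have hmem : ∀ m, r - 1 ≤ m → scaledSpline r (r - 1) 0 ∈ Submodule.span ℝ
      (Set.range fun i : Fin (2 ^ m - r + 1) => scaledSpline r m i) := by
    intro m hm
    induction m, hm using Nat.le_induction with
    | base => exact Submodule.subset_span ⟨⟨0, by omega⟩, rfl⟩
    | succ m hm ih =>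
      refine (Submodule.span_le.2 ?_) ih
      rintro _ ⟨i, rfl⟩
      refine scaledSpline_mem_span_succ hr ?_ i.2
      calc r ≤ 2 ^ (r - 1) := by rcases hr with rfl | rfl <;> norm_num
        _ ≤ 2 ^ m := Nat.pow_le_pow_right (by norm_num) hm
  obtain ⟨c, hc⟩ := (Submodule.mem_span_range_iff_exists_fun ℝ).1 (hmem n hle)
  refine ⟨c, fun x => ?_⟩
  rw [← hc]
  simp

/-! ### L² stability of the basis -/

/-- The integral is (a² + ab + b²)/3, minimised over a at a = -b/2. -/
theorem sq_div_four_le_integral_affine_sq (a b : ℝ) :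
    b ^ 2 / 4 ≤ ∫ t in (0 : ℝ)..1, (a * (1 - t) + b * t) ^ 2 := by
  have h : ∀ t ∈ Set.uIcc (0 : ℝ) 1, HasDerivAt
      (fun t : ℝ => a ^ 2 * t + a * (b - a) * t ^ 2 + (b - a) ^ 2 / 3 * t ^ 3)
      ((a * (1 - t) + b * t) ^ 2) t := by
    intro t _
    have := (((hasDerivAt_id t).const_mul (a ^ 2)).add
      ((hasDerivAt_pow 2 t).const_mul (a * (b - a)))).add
      ((hasDerivAt_pow 3 t).const_mul ((b - a) ^ 2 / 3))
    refine this.congr_deriv ?_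
    push_cast
    ring
  rw [intervalIntegral.integral_eq_sub_of_hasDerivAt h
    (Continuous.intervalIntegrable (by fun_prop) _ _)]
  nlinarith [sq_nonneg (2 * a + b)]

theorem integrableOn_sq_of_bounded {f : ℝ → ℝ} (hf : Measurable f) {C : ℝ} (hC : ∀ x, |f x| ≤ C)
    {s : Set ℝ} (hs : volume s ≠ ⊤) : IntegrableOn (fun x => f x ^ 2) s :=
  Measure.integrableOn_of_bounded hs (hf.pow_const 2).aestronglyMeasurable
    (M := C ^ 2) (Filter.Eventually.of_forall fun x => by
      rw [norm_pow, Real.norm_eq_abs]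
      exact pow_le_pow_left₀ (abs_nonneg _) (hC x) 2)

theorem abs_sum_spline_le {r N : ℕ} (c a : Fin N → ℝ) :
    |∑ j, c j * spline r (a j)| ≤ ∑ j, |c j| := by
  refine (Finset.abs_sum_le_sum_abs _ _).trans (Finset.sum_le_sum fun j _ => ?_)
  rw [abs_mul, abs_of_nonneg (spline_nonneg _ _)]
  exact mul_le_of_le_one_right (abs_nonneg _) (spline_le_one _ _)

/-- Inside the cell (k, k+1) the spline is affine with value c_k at the right end, whatever its left
value. Assigning c_k to that cell makes the estimates on different cells summable without loss. -/
theorem sq_div_four_le_integral_sum_spline {r : ℕ} (hr : r = 1 ∨ r = 2) {N : ℕ} (c : Fin N → ℝ)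
    (k : Fin N) :
    c k ^ 2 / 4 ≤ ∫ z in ((k : ℕ) : ℝ)..((k : ℕ) : ℝ) + 1,
      (∑ j, c j * spline r (z - ((j : ℕ) : ℝ))) ^ 2 := by
  classical
  have hsub : (∫ z in ((k : ℕ) : ℝ)..((k : ℕ) : ℝ) + 1,
      (∑ j, c j * spline r (z - ((j : ℕ) : ℝ))) ^ 2)
      = ∫ t in (0 : ℝ)..1, (∑ j, c j * spline r (t + (k : ℕ) - ((j : ℕ) : ℝ))) ^ 2 := by
    rw [intervalIntegral.integral_comp_add_right
      (fun t => (∑ j, c j * spline r (t - ((j : ℕ) : ℝ))) ^ 2), zero_add, add_comm 1]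
  rw [hsub]
  obtain ⟨a, ha⟩ : ∃ a : ℝ, ∀ t ∈ Set.Ioo (0 : ℝ) 1,
      ∑ j, c j * spline r (t + (k : ℕ) - ((j : ℕ) : ℝ)) = a * (1 - t) + c k * t := by
    rcases hr with rfl | rfl
    · refine ⟨c k, fun t ht => ?_⟩
      rw [Finset.sum_eq_single k]
      · rw [add_sub_cancel_right, spline_one_of_mem ht.1.le ht.2]
        ring
      · intro j _ hj
        rw [spline_eq_zero (Or.inl rfl), mul_zero]
        rcases lt_or_gt_of_ne hj with h | h
        · right
          have : ((j : ℕ) : ℝ) + 1 ≤ (k : ℕ) := by exact_mod_cast h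
          push_cast
          linarith [ht.1]
        · left
          have : ((k : ℕ) : ℝ) + 1 ≤ (j : ℕ) := by exact_mod_cast h
          linarith [ht.2]
      · simp
    -- The left value is the preceding coefficient, or 0 when k = 0.
    · refine ⟨∑ j : Fin N, if (j : ℕ) + 1 = k then c j else 0, fun t ht => ?_⟩
      have : ∀ j : Fin N, c j * spline 2 (t + (k : ℕ) - ((j : ℕ) : ℝ))
          = (if (j : ℕ) + 1 = k then c j else 0) * (1 - t) + if j = k then c j * t else 0 := by
        intro j
        rcases lt_trichotomy (j : ℕ) (k : ℕ) with h | h | h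
        · rw [if_neg (show ¬j = k from fun h' => by rw [h'] at h; exact lt_irrefl _ h), add_zero]
          rcases eq_or_ne ((j : ℕ) + 1) k with h1 | h1
          · rw [if_pos h1]
            have : ((k : ℕ) : ℝ) = (j : ℕ) + 1 := by exact_mod_cast h1.symm
            rw [this, spline_two_of_mem_right (by linarith [ht.1]) (by linarith [ht.2])]
            ring
          · rw [if_neg h1]
            have : ((j : ℕ) : ℝ) + 2 ≤ (k : ℕ) := by
              have : (j : ℕ) + 2 ≤ k := by omega
              exact_mod_cast this
            rw [spline_two_of_two_le (by linarith [ht.1])]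
            ring
        · have hjk : j = k := Fin.ext h
          subst hjk
          rw [if_pos rfl, if_neg (by omega), add_sub_cancel_right,
            spline_two_of_mem_left ht.1.le ht.2.le]
          ring
        · rw [if_neg (show ¬j = k from fun h' => by rw [h'] at h; exact lt_irrefl _ h), if_neg (by omega)]
          have : ((k : ℕ) : ℝ) + 1 ≤ (j : ℕ) := by exact_mod_cast h
          rw [spline_two_of_nonpos (by linarith [ht.2])]
          ring
      rw [Finset.sum_congr rfl fun j _ => this j, Finset.sum_add_distrib, ← Finset.sum_mul]
      simp
  refine (sq_div_four_le_integral_affine_sq a (c k)).trans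
    (intervalIntegral.integral_mono_on_of_le_Ioo zero_le_one
      (Continuous.intervalIntegrable (by fun_prop) _ _) ?_ fun t ht => by rw [ha t ht])
  rw [intervalIntegrable_iff_integrableOn_Ioc_of_le zero_le_one]
  refine integrableOn_sq_of_bounded ?_ (fun t => abs_sum_spline_le c _) (by simp)
  exact Finset.measurable_sum _ fun j _ => ((measurable_spline r).comp (by fun_prop)).const_mul _

theorem rpow_half_sq (n : ℕ) : ((2 : ℝ) ^ ((n : ℝ) / 2)) ^ 2 = 2 ^ n := by
  rw [← Real.rpow_natCast, ← Real.rpow_mul zero_le_two, ← Real.rpow_natCast]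
  congr 1
  push_cast
  ring

/-- The `L²` stability of the B-spline basis. -/
theorem sum_sq_div_four_le_integral {r : ℕ} (hr : r = 1 ∨ r = 2) {n : ℕ} (hn : r ≤ 2 ^ n)
    (c : Fin (2 ^ n - r + 1) → ℝ) :
    (∑ j, c j ^ 2) / 4 ≤ ∫ x in Set.Icc (0 : ℝ) 1, (∑ j, c j * scaledSpline r n j x) ^ 2 := by
  set w : ℝ → ℝ := fun z => ∑ j, c j * spline r (z - ((j : ℕ) : ℝ)) with hw
  have hwm : Measurable w :=
    Finset.measurable_sum _ fun j _ => ((measurable_spline r).comp (by fun_prop)).const_mul _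
  have hint : ∀ a b : ℝ, IntervalIntegrable (fun z => w z ^ 2) volume a b := fun a b =>
    intervalIntegrable_iff.2
      (integrableOn_sq_of_bounded hwm (fun t => abs_sum_spline_le c _) (by simp [Set.uIoc]))
  have h1 : ∀ x, (∑ j, c j * scaledSpline r n j x) ^ 2 = 2 ^ n * w (2 ^ n * x) ^ 2 := by
    intro x
    have : ∑ j, c j * scaledSpline r n j x = (2 : ℝ) ^ ((n : ℝ) / 2) * w (2 ^ n * x) := by
      simp only [hw, scaledSpline, Finset.mul_sum]
      exact Finset.sum_congr rfl fun j _ => by ring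
    rw [this, mul_pow, rpow_half_sq]
  rw [integral_Icc_eq_integral_Ioc, ← intervalIntegral.integral_of_le zero_le_one]
  simp only [h1]
  rw [intervalIntegral.integral_const_mul,
    intervalIntegral.integral_comp_mul_left (fun z => w z ^ 2) (by positivity), smul_eq_mul,
    mul_inv_cancel_left₀ (by positivity), mul_zero, mul_one]
  have h2 : ∫ z in (0 : ℝ)..2 ^ n, w z ^ 2
      = ∑ k ∈ Finset.range (2 ^ n), ∫ z in (k : ℝ)..(k : ℝ) + 1, w z ^ 2 := by
    have := intervalIntegral.sum_integral_adjacent_intervals (f := fun z => w z ^ 2)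
      (a := fun k : ℕ => (k : ℝ)) (n := 2 ^ n) (μ := volume) fun k _ => hint _ _
    push_cast at this
    rw [this]
  -- There are 2^n cells; for r = 2 the last one has no coefficient of its own, and its nonnegative
  -- integral is dropped.
  have h3 : 2 ^ n - r + 1 ≤ 2 ^ n := by rcases hr with rfl | rfl <;> omega
  rw [h2]
  calc (∑ j, c j ^ 2) / 4 = ∑ k, c k ^ 2 / 4 := by rw [Finset.sum_div]
    _ ≤ ∑ k : Fin (2 ^ n - r + 1), ∫ z in ((k : ℕ) : ℝ)..((k : ℕ) : ℝ) + 1, w z ^ 2 :=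
        Finset.sum_le_sum fun k _ => sq_div_four_le_integral_sum_spline hr c k
    _ = ∑ k ∈ Finset.range (2 ^ n - r + 1), ∫ z in (k : ℝ)..(k : ℝ) + 1, w z ^ 2 :=
        (Finset.sum_range (fun k : ℕ => ∫ z in (k : ℝ)..(k : ℝ) + 1, w z ^ 2)).symm
    _ ≤ _ := Finset.sum_le_sum_of_subset_of_nonneg (Finset.range_mono h3) fun k _ _ =>
        intervalIntegral.integral_nonneg (by linarith) fun _ _ => sq_nonneg _

theorem abs_scaledSpline_le (r n j : ℕ) (x : ℝ) :
    |scaledSpline r n j x| ≤ (2 : ℝ) ^ ((n : ℝ) / 2) := by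
  rw [scaledSpline, abs_mul, abs_of_pos (by positivity), abs_of_nonneg (spline_nonneg _ _)]
  exact mul_le_of_le_one_right (by positivity) (spline_le_one _ _)

theorem scaledSpline_eq_zero {r : ℕ} (hr : r = 1 ∨ r = 2) {n j : ℕ} (hn : r ≤ 2 ^ n)
    (hj : j < 2 ^ n - r + 1) {x : ℝ} (hx : x < 0 ∨ 1 ≤ x) : scaledSpline r n j x = 0 := by
  rw [scaledSpline, spline_eq_zero hr, mul_zero]
  rcases hx with hx | hx
  · left
    have : (2 : ℝ) ^ n * x < 0 := mul_neg_of_pos_of_neg (by positivity) hx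
    have : (0 : ℝ) ≤ j := Nat.cast_nonneg j
    linarith
  · right
    have h1 : (2 : ℝ) ^ n * 1 ≤ 2 ^ n * x := by gcongr
    have h2 : ((j + r : ℕ) : ℝ) ≤ ((2 ^ n : ℕ) : ℝ) := by
      have : j + r ≤ 2 ^ n := by omega
      exact_mod_cast this
    push_cast at h2
    linarith

theorem integral_scaledSpline_sq_le {r : ℕ} (hr : r = 1 ∨ r = 2) (n j : ℕ) :
    ∫ x in Set.Icc (0 : ℝ) 1, scaledSpline r n j x ^ 2 ≤ 2 := by
  have hsupp : ∀ z, spline r z ^ 2 ≤ Set.indicator (Set.Icc (0 : ℝ) 2) (fun _ => 1) z := by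
    intro z
    by_cases hz : z ∈ Set.Icc (0 : ℝ) 2
    · rw [Set.indicator_of_mem hz]
      exact pow_le_one₀ (spline_nonneg _ _) (spline_le_one _ _)
    · rw [Set.indicator_of_notMem hz, spline_eq_zero hr]
      · norm_num
      · by_contra! h
        have hr2 : (r : ℝ) ≤ 2 := by rcases hr with rfl | rfl <;> norm_num
        exact hz ⟨h.1, h.2.le.trans hr2⟩
  have hind : Integrable (Set.indicator (Set.Icc (0 : ℝ) 2) fun _ => (1 : ℝ)) :=
    (integrable_indicator_iff measurableSet_Icc).2 (by simp)
  have hspl : Integrable (fun z => spline r z ^ 2) := by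
    refine hind.mono' ((measurable_spline r).pow_const 2).aestronglyMeasurable
      (Filter.Eventually.of_forall fun z => ?_)
    rw [Real.norm_of_nonneg (sq_nonneg _)]
    exact hsupp z
  have hscaled : ∀ x, scaledSpline r n j x ^ 2 = 2 ^ n * spline r (2 ^ n * x - j) ^ 2 := by
    intro x
    rw [scaledSpline, mul_pow, rpow_half_sq]
  simp only [hscaled]
  have hint : Integrable (fun x : ℝ => (2 : ℝ) ^ n * spline r (2 ^ n * x - j) ^ 2) :=
    ((hspl.comp_sub_right (j : ℝ)).comp_mul_left' (by positivity)).const_mul _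
  calc _ ≤ ∫ x : ℝ, (2 : ℝ) ^ n * spline r (2 ^ n * x - j) ^ 2 :=
        setIntegral_le_integral hint (Filter.Eventually.of_forall fun x => by positivity)
    _ = ∫ z, spline r z ^ 2 := by
        rw [integral_const_mul, Measure.integral_comp_mul_left (fun z => spline r (z - j) ^ 2),
          integral_sub_right_eq_self (fun z => spline r z ^ 2), abs_of_pos (by positivity),
          smul_eq_mul, mul_inv_cancel_left₀ (by positivity)]
    _ ≤ ∫ z, Set.indicator (Set.Icc (0 : ℝ) 2) (fun _ => 1) z := integral_mono hspl hind hsupp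
    _ = 2 := by
        rw [integral_indicator measurableSet_Icc]
        simp

/-- The `L²` norm of a spline is bounded by the Euclidean norm of its coefficients. -/
theorem integral_sum_scaledSpline_sq_le {r : ℕ} (hr : r = 1 ∨ r = 2) (n : ℕ) {N : ℕ}
    (c : Fin N → ℝ) :
    ∫ x in Set.Icc (0 : ℝ) 1, (∑ j, c j * scaledSpline r n j x) ^ 2 ≤ 4 * ∑ j, c j ^ 2 := by
  have hint : ∀ j : Fin N, IntegrableOn (fun x => scaledSpline r n j x ^ 2) (Set.Icc (0 : ℝ) 1) :=
    fun j => integrableOn_sq_of_bounded (measurable_scaledSpline r n j)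
      (abs_scaledSpline_le r n j) (by simp)
  have hsum : IntegrableOn (fun x => 2 * ∑ j : Fin N, c j ^ 2 * scaledSpline r n j x ^ 2)
      (Set.Icc (0 : ℝ) 1) :=
    (integrable_finsetSum _ fun j _ => (hint j).const_mul _).const_mul _
  calc _ ≤ ∫ x in Set.Icc (0 : ℝ) 1, 2 * ∑ j, c j ^ 2 * scaledSpline r n j x ^ 2 := by
        refine integral_mono_of_nonneg (Filter.Eventually.of_forall fun x => sq_nonneg _) hsum
          (Filter.Eventually.of_forall fun x => sq_sum_scaledSpline_le hr n c x)
    _ = 2 * ∑ j, c j ^ 2 * ∫ x in Set.Icc (0 : ℝ) 1, scaledSpline r n j x ^ 2 := by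
        rw [integral_const_mul, integral_finsetSum _ fun j _ => (hint j).const_mul _]
        simp only [integral_const_mul]
    _ ≤ 2 * ∑ j, c j ^ 2 * 2 := by
        gcongr with j _
        exact integral_scaledSpline_sq_le hr n j
    _ = 4 * ∑ j, c j ^ 2 := by rw [← Finset.sum_mul]; ring

/-! ### The tempered energy and its coercivity -/

/-- The singular tempered kernel. -/
def kernel (β lam : ℝ) (z : ℝ × ℝ) : ℝ :=
  (Real.exp (lam * |z.1 - z.2|) * |z.1 - z.2| ^ (1 + β))⁻¹

/-- The Gagliardo-type energy of a function with respect to the tempered kernel. -/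
def energy (β lam : ℝ) (u : ℝ → ℝ) : ℝ :=
  ∫ z : ℝ × ℝ, (u z.1 - u z.2) ^ 2 * kernel β lam z

theorem kernel_nonneg (β lam : ℝ) (z : ℝ × ℝ) : 0 ≤ kernel β lam z := by
  unfold kernel
  positivity

theorem measurable_kernel (β lam : ℝ) : Measurable (kernel β lam) := by
  unfold kernel
  fun_prop

theorem kernel_anti (β : ℝ) {lam lam' : ℝ} (h : lam ≤ lam') (z : ℝ × ℝ) :
    kernel β lam' z ≤ kernel β lam z := by
  unfold kernel
  -- Where the power vanishes, both kernels take the default value 0⁻¹ = 0.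
  rcases (show (0 : ℝ) ≤ |z.1 - z.2| ^ (1 + β) by positivity).eq_or_lt with h0 | h0
  · rw [← h0]; simp
  · refine inv_anti₀ (by positivity) ?_
    gcongr

theorem measurable_energyDensity {u : ℝ → ℝ} (hu : Measurable u) (β lam : ℝ) :
    Measurable fun z : ℝ × ℝ => (u z.1 - u z.2) ^ 2 * kernel β lam z :=
  (((hu.comp measurable_fst).sub (hu.comp measurable_snd)).pow_const 2).mul (measurable_kernel _ _)

theorem integrable_energyDensity_of_le {u : ℝ → ℝ} (hu : Measurable u) {β lam lam' : ℝ}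
    (h : lam ≤ lam')
    (hint : Integrable fun z : ℝ × ℝ => (u z.1 - u z.2) ^ 2 * kernel β lam z) :
    Integrable fun z : ℝ × ℝ => (u z.1 - u z.2) ^ 2 * kernel β lam' z := by
  refine hint.mono' (measurable_energyDensity hu _ _).aestronglyMeasurable
    (Filter.Eventually.of_forall fun z => ?_)
  rw [Real.norm_of_nonneg (mul_nonneg (sq_nonneg _) (kernel_nonneg _ _ _))]
  exact mul_le_mul_of_nonneg_left (kernel_anti β h z) (sq_nonneg _)

theorem energy_anti {u : ℝ → ℝ} (hu : Measurable u) {β lam lam' : ℝ} (h : lam ≤ lam')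
    (hint : Integrable fun z : ℝ × ℝ => (u z.1 - u z.2) ^ 2 * kernel β lam z) :
    energy β lam' u ≤ energy β lam u :=
  integral_mono (integrable_energyDensity_of_le hu h hint) hint fun z =>
    mul_le_mul_of_nonneg_left (kernel_anti β h z) (sq_nonneg _)

/-- The energy of a function supported in `[0,2]` controls its `L²` norm on `[0,1]`. -/
theorem le_energy {β lam : ℝ} (hβ : 0 < β) (hlam : 0 ≤ lam) {u : ℝ → ℝ} (hu : Measurable u)
    {C : ℝ} (hC : ∀ x, |u x| ≤ C) (h0 : ∀ x, 2 ≤ x → u x = 0)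
    (hint : Integrable fun z : ℝ × ℝ => (u z.1 - u z.2) ^ 2 * kernel β lam z) :
    (Real.exp (lam * 3) * 3 ^ (1 + β))⁻¹ * ∫ x in Set.Icc (0 : ℝ) 1, u x ^ 2
      ≤ energy β lam u := by
  -- On [0,1] × [2,3] the distance is at most 3, so κ bounds the kernel below there; u vanishes in
  -- the second variable, whose interval has length 1.
  set κ : ℝ := (Real.exp (lam * 3) * 3 ^ (1 + β))⁻¹ with hκ
  have hint2 : IntegrableOn (fun z : ℝ × ℝ => κ * u z.1 ^ 2)
      (Set.Icc (0 : ℝ) 1 ×ˢ Set.Icc (2 : ℝ) 3) (volume.prod volume) := by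
    rw [IntegrableOn, ← Measure.prod_restrict]
    exact ((integrableOn_sq_of_bounded hu hC (by simp)).const_mul κ).comp_fst
      (volume.restrict (Set.Icc (2 : ℝ) 3))
  calc κ * ∫ x in Set.Icc (0 : ℝ) 1, u x ^ 2
      = ∫ z in Set.Icc (0 : ℝ) 1 ×ˢ Set.Icc (2 : ℝ) 3, κ * u z.1 ^ 2 ∂(volume.prod volume) := by
        rw [setIntegral_prod _ hint2]
        simp only [setIntegral_const, integral_const_mul]
        norm_num
    _ ≤ ∫ z in Set.Icc (0 : ℝ) 1 ×ˢ Set.Icc (2 : ℝ) 3, (u z.1 - u z.2) ^ 2 * kernel β lam z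
          ∂(volume.prod volume) := by
        refine setIntegral_mono_on hint2 hint.integrableOn
          (measurableSet_Icc.prod measurableSet_Icc) ?_
        rintro ⟨x, y⟩ ⟨hx, hy⟩
        simp only [Set.mem_Icc] at hx hy
        have hxy : |x - y| = y - x := by
          rw [abs_of_neg (by linarith), neg_sub]
        simp only [h0 y hy.1, sub_zero, kernel, hxy]
        rw [mul_comm]
        refine mul_le_mul_of_nonneg_left ?_ (sq_nonneg _)
        have hpos : 0 < y - x := by linarith
        rw [hκ]
        refine inv_anti₀ (by positivity) ?_
        have h3 : y - x ≤ 3 := by linarith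
        gcongr
    _ ≤ energy β lam u :=
        setIntegral_le_integral hint (Filter.Eventually.of_forall fun z =>
          mul_nonneg (sq_nonneg _) (kernel_nonneg _ _ _))

/-! ### Finite energy of the generator -/

theorem lintegral_le_of_le_indicator_union {f : ℝ → ℝ} {m a b a' b' : ℝ}
    (hm : 0 ≤ m) (hab : a ≤ b) (hab' : a' ≤ b')
    (h : ∀ x, f x ≤ Set.indicator (Set.Icc a b ∪ Set.Icc a' b') (fun _ => m) x) :
    ∫⁻ x, ENNReal.ofReal (f x) ≤ ENNReal.ofReal (m * ((b - a) + (b' - a'))) := by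
  calc ∫⁻ x, ENNReal.ofReal (f x)
      ≤ ∫⁻ x, Set.indicator (Set.Icc a b ∪ Set.Icc a' b') (fun _ => ENNReal.ofReal m) x := by
        refine lintegral_mono fun x => (ENNReal.ofReal_le_ofReal (h x)).trans_eq ?_
        by_cases hx : x ∈ Set.Icc a b ∪ Set.Icc a' b'
        · rw [Set.indicator_of_mem hx, Set.indicator_of_mem hx]
        · rw [Set.indicator_of_notMem hx, Set.indicator_of_notMem hx, ENNReal.ofReal_zero]
    _ = ENNReal.ofReal m * volume (Set.Icc a b ∪ Set.Icc a' b') := by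
        rw [lintegral_indicator_const (measurableSet_Icc.union measurableSet_Icc)]
    _ ≤ ENNReal.ofReal m * (volume (Set.Icc a b) + volume (Set.Icc a' b')) := by
        gcongr
        exact measure_union_le _ _
    _ = _ := by
        rw [Real.volume_Icc, Real.volume_Icc, ← ENNReal.ofReal_add (by linarith) (by linarith),
          ← ENNReal.ofReal_mul hm]

theorem sq_spline_sub_le_one (r : ℕ) (x y : ℝ) : (spline r x - spline r y) ^ 2 ≤ 1 := by
  have h1 := spline_nonneg r x
  have h2 := spline_nonneg r y
  have h3 := spline_le_one r x
  have h4 := spline_le_one r y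
  nlinarith

theorem spline_eq_zero_of_notMem_Icc {r : ℕ} (hr : r = 1 ∨ r = 2) {x : ℝ}
    (hx : x ∉ Set.Icc (0 : ℝ) 2) : spline r x = 0 := by
  refine spline_eq_zero hr ?_
  by_contra! h
  have hr2 : (r : ℝ) ≤ 2 := by rcases hr with rfl | rfl <;> norm_num
  exact hx ⟨h.1, h.2.le.trans hr2⟩

theorem abs_spline_two_sub_le (x y : ℝ) : |spline 2 x - spline 2 y| ≤ |x - y| := by
  rw [spline_two, spline_two]
  refine (abs_max_sub_max_le_max _ _ _ _).trans ?_
  rw [sub_self, abs_zero, max_eq_right (abs_nonneg _), sub_sub_sub_cancel_left]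
  refine (abs_abs_sub_abs_le_abs_sub _ _).trans_eq ?_
  rw [sub_sub_sub_cancel_right, abs_sub_comm]

/-- For small h, the indicator changes only within |h| of its two jumps (total length 4|h|), while
the hat is 1-Lipschitz and the difference lives on [-1, 3]. For |h| ≥ 1, the two supports have total
length at most 4. The exponent r is what makes β < r the right condition. -/
theorem lintegral_sq_spline_sub_le {r : ℕ} (hr : r = 1 ∨ r = 2) (h : ℝ) :
    ∫⁻ x, ENNReal.ofReal ((spline r x - spline r (x + h)) ^ 2)
      ≤ ENNReal.ofReal (4 * min 1 |h| ^ r) := by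
  rcases le_total 1 |h| with h1 | h1
  · rw [min_eq_left h1, one_pow]
    refine (lintegral_le_of_le_indicator_union (m := 1) (a := 0) (b := 2) (a' := -h) (b' := 2 - h)
      zero_le_one (by norm_num) (by linarith) fun x => ?_).trans
      (ENNReal.ofReal_le_ofReal (by linarith))
    by_cases hx : x ∈ Set.Icc (0 : ℝ) 2 ∪ Set.Icc (-h) (2 - h)
    · rw [Set.indicator_of_mem hx]
      exact sq_spline_sub_le_one _ _ _
    · rw [Set.indicator_of_notMem hx]
      simp only [Set.mem_union, Set.mem_Icc, not_or] at hx
      rw [spline_eq_zero_of_notMem_Icc hr hx.1, spline_eq_zero_of_notMem_Icc hr]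
      · simp
      · rintro ⟨h2, h3⟩
        exact hx.2 ⟨by linarith, by linarith⟩
  · rw [min_eq_right h1]
    have habs := abs_le.1 (le_refl |h|)
    have h0 := abs_nonneg h
    rcases hr with rfl | rfl
    · refine (lintegral_le_of_le_indicator_union (m := 1) (a := -|h|) (b := |h|) (a' := 1 - |h|)
        (b' := 1 + |h|) zero_le_one (by linarith) (by linarith) fun x => ?_).trans
        (ENNReal.ofReal_le_ofReal (by linarith))
      by_cases hx : x ∈ Set.Icc (-|h|) |h| ∪ Set.Icc (1 - |h|) (1 + |h|)
      · rw [Set.indicator_of_mem hx]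
        exact sq_spline_sub_le_one _ _ _
      · rw [Set.indicator_of_notMem hx]
        simp only [Set.mem_union, Set.mem_Icc, not_or, not_and_or, not_le] at hx
        have hz : ∀ {y : ℝ}, y < 0 ∨ 1 ≤ y → spline 1 y = 0 := fun h =>
          spline_eq_zero (Or.inl rfl) (by simpa using h)
        have : spline 1 x = spline 1 (x + h) := by
          rcases hx.1 with h2 | h2
          · rw [hz (Or.inl (by linarith)), hz (Or.inl (by linarith))]
          · rcases hx.2 with h3 | h3
            · rw [spline_one_of_mem (by linarith) (by linarith),
                spline_one_of_mem (by linarith) (by linarith)]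
            · rw [hz (Or.inr (by linarith)), hz (Or.inr (by linarith))]
        rw [this]
        simp
    · refine (lintegral_le_of_le_indicator_union (m := |h| ^ 2) (a := -1) (b := 3) (a' := 0)
        (b' := 0) (by positivity) (by linarith) (by linarith) fun x => ?_).trans
        (ENNReal.ofReal_le_ofReal (by linarith))
      by_cases hx : x ∈ Set.Icc (-1 : ℝ) 3 ∪ Set.Icc 0 0
      · rw [Set.indicator_of_mem hx, ← sq_abs]
        refine pow_le_pow_left₀ (abs_nonneg _) ?_ 2
        refine (abs_spline_two_sub_le _ _).trans_eq ?_
        rw [sub_add_cancel_left, abs_neg]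
      · rw [Set.indicator_of_notMem hx]
        simp only [Set.mem_union, Set.mem_Icc, not_or] at hx
        rw [spline_eq_zero_of_notMem_Icc (Or.inr rfl), spline_eq_zero_of_notMem_Icc (Or.inr rfl)]
        · simp
        · rintro ⟨h2, h3⟩
          exact hx.1 ⟨by linarith, by linarith⟩
        · rintro ⟨h2, h3⟩
          exact hx.1 ⟨by linarith, by linarith⟩

theorem integrable_comp_abs_of_integrableOn_Ioi {f : ℝ → ℝ} (hf : IntegrableOn f (Set.Ioi 0)) :
    Integrable fun x => f |x| := by
  have h1 : IntegrableOn (fun x => f |x|) (Set.Ioi 0) :=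
    hf.congr_fun (fun x hx => by simp only [abs_of_pos (Set.mem_Ioi.1 hx)]) measurableSet_Ioi
  have h2 : IntegrableOn (fun x => f |x|) (Set.Iic 0) := by
    rw [← Measure.map_neg_eq_self (volume : Measure ℝ)]
    let m : MeasurableEmbedding fun x : ℝ => -x := (Homeomorph.neg ℝ).measurableEmbedding
    rw [m.integrableOn_map_iff]
    simp_rw [Function.comp_def, abs_neg, Set.neg_preimage, Set.neg_Iic, neg_zero]
    exact Iff.mpr integrableOn_Ici_iff_integrableOn_Ioi h1
  rw [← integrableOn_univ, ← Set.Iic_union_Ioi (a := (0 : ℝ))]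
  exact h2.union h1

theorem integrable_min_pow_mul_rpow {r : ℕ} {β : ℝ} (hβ : 0 < β) (hr : β < r) :
    Integrable fun h : ℝ => 4 * min 1 |h| ^ r * (|h| ^ (1 + β))⁻¹ := by
  refine integrable_comp_abs_of_integrableOn_Ioi (f := fun h => 4 * min 1 h ^ r * (h ^ (1 + β))⁻¹) ?_
  rw [← Set.Ioc_union_Ioi_eq_Ioi zero_le_one]
  refine IntegrableOn.union ?_ ?_
  · have h1 : IntegrableOn (fun h : ℝ => 4 * h ^ ((r : ℝ) - (1 + β))) (Set.Ioc 0 1) :=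
      (intervalIntegrable_iff_integrableOn_Ioc_of_le zero_le_one).1
        ((intervalIntegral.intervalIntegrable_rpow' (by linarith)).const_mul 4)
    refine h1.congr_fun (fun h hh => ?_) measurableSet_Ioc
    simp only [min_eq_right hh.2]
    rw [Real.rpow_sub hh.1, Real.rpow_natCast, div_eq_mul_inv, mul_assoc]
  · have h1 : IntegrableOn (fun h : ℝ => 4 * h ^ (-(1 + β))) (Set.Ioi 1) :=
      (integrableOn_Ioi_rpow_of_lt (by linarith) zero_lt_one).const_mul 4
    refine h1.congr_fun (fun h hh => ?_) measurableSet_Ioi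
    have hh' : (1 : ℝ) < h := hh
    simp only [min_eq_left hh'.le]
    rw [Real.rpow_neg (by linarith), one_pow, mul_one]

theorem integrable_energyDensity_spline {r : ℕ} (hr : r = 1 ∨ r = 2) {β lam : ℝ} (hβ : 0 < β)
    (hβr : β < r) (hlam : 0 ≤ lam) :
    Integrable fun z : ℝ × ℝ => (spline r z.1 - spline r z.2) ^ 2 * kernel β lam z := by
  refine integrable_energyDensity_of_le (measurable_spline r) hlam ?_
  -- In the variables (x, h) with y = x + h the untempered kernel depends on h alone, and Tonelli
  -- reduces the claim to the L² modulus of continuity.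
  have hmp : MeasurePreserving (fun z : ℝ × ℝ => (z.1, z.1 + z.2)) := measurePreserving_prod_add
    (volume : Measure ℝ) (volume : Measure ℝ)
  have hF := measurable_energyDensity (measurable_spline r) β 0
  have hemb : MeasurableEmbedding (fun z : ℝ × ℝ => (z.1, z.1 + z.2)) :=
    (MeasurableEquiv.shearAddRight ℝ).measurableEmbedding
  rw [← hmp.integrable_comp_emb hemb]
  have hG : Measurable ((fun z : ℝ × ℝ => (spline r z.1 - spline r z.2) ^ 2 * kernel β 0 z) ∘
      fun z : ℝ × ℝ => (z.1, z.1 + z.2)) := hF.comp hmp.measurable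
  refine ⟨hG.aestronglyMeasurable, ?_⟩
  have hpos : 0 ≤ᵐ[volume] ((fun z : ℝ × ℝ => (spline r z.1 - spline r z.2) ^ 2 * kernel β 0 z) ∘
      fun z : ℝ × ℝ => (z.1, z.1 + z.2)) := Filter.Eventually.of_forall fun z =>
    mul_nonneg (sq_nonneg _) (kernel_nonneg _ _ _)
  rw [hasFiniteIntegral_iff_ofReal hpos, Measure.volume_eq_prod,
    lintegral_prod_symm' _ hG.ennreal_ofReal]
  refine lt_of_le_of_lt (lintegral_mono fun h => ?_)
    (integrable_min_pow_mul_rpow hβ hβr).lintegral_lt_top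
  have hk : ∀ x : ℝ, kernel β 0 (x, x + h) = (|h| ^ (1 + β))⁻¹ := fun x => by
    simp [kernel]
  simp only [Function.comp, hk]
  have hk0 : 0 ≤ (|h| ^ (1 + β))⁻¹ := by positivity
  simp only [ENNReal.ofReal_mul (sq_nonneg _), ENNReal.ofReal_mul
    (show 0 ≤ 4 * min 1 |h| ^ r by positivity)]
  rw [lintegral_mul_const' _ _ ENNReal.ofReal_ne_top]
  gcongr
  exact lintegral_sq_spline_sub_le hr h

/-! ### Scaling and positivity of the energy -/

/-- The density of the energy of a basis function is a dilated translate of the density of the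
energy of the generator. -/
theorem energyDensity_scaledSpline (r n j : ℕ) (β lam : ℝ) (z : ℝ × ℝ) :
    (scaledSpline r n j z.1 - scaledSpline r n j z.2) ^ 2 * kernel β lam z
      = (2 : ℝ) ^ ((n : ℝ) * β) * (2 : ℝ) ^ (2 * n) *
        (fun w : ℝ × ℝ => (spline r w.1 - spline r w.2) ^ 2 * kernel β (lam / 2 ^ n) w)
          ((2 : ℝ) ^ n • z - ((j : ℝ), (j : ℝ))) := by
  have h2 : (0 : ℝ) < 2 ^ n := by positivity
  have h1 : ∀ x : ℝ, scaledSpline r n j x = (2 : ℝ) ^ ((n : ℝ) / 2) * spline r (2 ^ n * x - j) :=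
    fun x => rfl
  have h3 : |(2 : ℝ) ^ n * z.1 - j - (2 ^ n * z.2 - j)| = 2 ^ n * |z.1 - z.2| := by
    rw [sub_sub_sub_cancel_right, ← mul_sub, abs_mul, abs_of_pos h2]
  -- The kernel contributes 2^{n(1+β)} and the squared amplitude 2^n; of the product, 2^{2n} is the
  -- Jacobian of the dilation of the plane.
  have h4 : ((2 : ℝ) ^ n) ^ (1 + β) = 2 ^ n * (2 : ℝ) ^ ((n : ℝ) * β) := by
    rw [Real.rpow_add h2, Real.rpow_one, Real.rpow_mul zero_le_two, Real.rpow_natCast]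
  have h5 : lam / 2 ^ n * (2 ^ n * |z.1 - z.2|) = lam * |z.1 - z.2| := by
    field_simp
  simp only [kernel, Prod.fst_sub, Prod.snd_sub, Prod.smul_fst, Prod.smul_snd, smul_eq_mul, h3, h5,
    h1]
  rw [Real.mul_rpow h2.le (abs_nonneg _), h4, ← mul_sub, mul_pow, rpow_half_sq, pow_mul']
  have h6 : (0 : ℝ) < (2 : ℝ) ^ ((n : ℝ) * β) := by positivity
  rw [mul_inv, mul_inv, mul_inv, mul_inv]
  field_simp

theorem integrable_energyDensity_scaledSpline {r : ℕ} (hr : r = 1 ∨ r = 2) {β lam : ℝ}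
    (hβ : 0 < β) (hβr : β < r) (hlam : 0 ≤ lam) (n j : ℕ) :
    Integrable fun z : ℝ × ℝ =>
      (scaledSpline r n j z.1 - scaledSpline r n j z.2) ^ 2 * kernel β lam z := by
  simp only [energyDensity_scaledSpline]
  refine Integrable.const_mul ?_ _
  have h := integrable_energyDensity_spline hr hβ hβr (lam := lam / 2 ^ n) (by positivity)
  have h' := h.comp_sub_right ((j : ℝ), (j : ℝ))
  exact (integrable_comp_smul_iff volume _ (by positivity)).2 h'

theorem energy_scaledSpline (r n j : ℕ) (β lam : ℝ) :
    energy β lam (scaledSpline r n j)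
      = (2 : ℝ) ^ ((n : ℝ) * β) * energy β (lam / 2 ^ n) (spline r) := by
  unfold energy
  simp only [energyDensity_scaledSpline]
  rw [integral_const_mul, Measure.integral_comp_smul volume (fun z : ℝ × ℝ =>
    (fun w : ℝ × ℝ => (spline r w.1 - spline r w.2) ^ 2 * kernel β (lam / 2 ^ n) w)
      (z - ((j : ℝ), (j : ℝ)))), integral_sub_right_eq_self (fun w : ℝ × ℝ =>
        (spline r w.1 - spline r w.2) ^ 2 * kernel β (lam / 2 ^ n) w)]
  rw [Module.finrank_prod, Module.finrank_self, abs_of_pos (by positivity), smul_eq_mul, mul_assoc,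
    ← pow_mul, mul_comm n, mul_inv_cancel_left₀ (by positivity)]

theorem energy_spline_pos {r : ℕ} (hr : r = 1 ∨ r = 2) {β lam : ℝ} (hβ : 0 < β)
    (hβr : β < r) (hlam : 0 ≤ lam) : 0 < energy β lam (spline r) := by
  have h1 : ∀ x, |spline r x| ≤ 1 := fun x => by
    rw [abs_of_nonneg (spline_nonneg _ _)]
    exact spline_le_one _ _
  refine lt_of_lt_of_le ?_ (le_energy hβ hlam (measurable_spline r) h1
    (fun x hx => spline_eq_zero hr (Or.inr ?_)) (integrable_energyDensity_spline hr hβ hβr hlam))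
  · refine mul_pos (by positivity) ?_
    have h2 : (0 : ℝ) < ∫ x in Set.Ico (0 : ℝ) 1, x ^ 2 := by
      rw [integral_Ico_eq_integral_Ioo, ← integral_Ioc_eq_integral_Ioo,
        ← intervalIntegral.integral_of_le zero_le_one]
      norm_num [integral_pow]
    rw [integral_Icc_eq_integral_Ico]
    refine h2.trans_le (setIntegral_mono_on ?_
      (integrableOn_sq_of_bounded (measurable_spline r) h1 (by simp)) measurableSet_Ico
      fun x hx => pow_le_pow_left₀ hx.1 (self_le_spline hx) 2)
    exact ((continuous_pow 2).integrableOn_Icc).mono_set Set.Ico_subset_Icc_self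
  · have hr2 : (r : ℝ) ≤ 2 := by rcases hr with rfl | rfl <;> norm_num
    exact hr2.trans hx

/-! ### From the bilinear form to the energy -/

theorem cConst_pos {β : ℝ} (hβ : 0 < β) (hβ2 : β < 2) (lam : ℝ) : 0 < cConst β lam := by
  unfold cConst
  split_ifs with h
  · have h1 : 0 < Real.Gamma ((1 + β) / 2) := Real.Gamma_pos_of_pos (by linarith)
    have h2 : 0 < Real.Gamma (1 - β / 2) := Real.Gamma_pos_of_pos (by linarith)
    have := Real.pi_pos
    positivity
  · have h1 : 0 < Real.Gamma (1 / 2) := Real.Gamma_pos_of_pos (by norm_num)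
    have h2 : 0 < |Real.Gamma (-β)| := by
      -- The only pole of Γ(-β) with 0 < β < 2 is β = 1, which the other branch handles.
      refine abs_pos.2 (Real.Gamma_ne_zero fun m hm => ?_)
      have hm' : β = m := neg_injective hm
      rw [hm'] at hβ hβ2 h
      have h3 : 0 < m := by exact_mod_cast hβ
      have h4 : m < 2 := by exact_mod_cast hβ2
      have h5 : m = 1 := by omega
      exact h (Or.inr (by rw [h5, Nat.cast_one]))
    have := Real.pi_pos
    positivity

theorem integrable_mul_energyDensity {p v : ℝ → ℝ} (hp : Measurable p) (hv : Measurable v)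
    {β lam : ℝ}
    (hpi : Integrable fun z : ℝ × ℝ => (p z.1 - p z.2) ^ 2 * kernel β lam z)
    (hvi : Integrable fun z : ℝ × ℝ => (v z.1 - v z.2) ^ 2 * kernel β lam z) :
    Integrable fun z : ℝ × ℝ => (p z.1 - p z.2) * (v z.1 - v z.2) * kernel β lam z := by
  refine (hpi.add hvi).mono' ?_ (Filter.Eventually.of_forall fun z => ?_)
  · exact ((((hp.comp measurable_fst).sub (hp.comp measurable_snd)).mul
      ((hv.comp measurable_fst).sub (hv.comp measurable_snd))).mul
        (measurable_kernel _ _)).aestronglyMeasurable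
  · have hk := kernel_nonneg β lam z
    rw [Real.norm_eq_abs, abs_mul, abs_of_nonneg hk, Pi.add_apply, ← add_mul]
    refine mul_le_mul_of_nonneg_right ?_ hk
    rw [abs_le]
    constructor <;> nlinarith [sq_nonneg ((p z.1 - p z.2) + (v z.1 - v z.2)),
      sq_nonneg ((p z.1 - p z.2) - (v z.1 - v z.2)), sq_nonneg (p z.1 - p z.2),
      sq_nonneg (v z.1 - v z.2)]

theorem bilin_eq_integral_prod {p v p' v' : ℝ → ℝ} (hp : p' =ᵐ[volume] p)
    (hv : v' =ᵐ[volume] v) {β lam : ℝ}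
    (hint : Integrable fun z : ℝ × ℝ => (p z.1 - p z.2) * (v z.1 - v z.2) * kernel β lam z) :
    bilin β lam p' v' = cConst β lam / 2 *
      ∫ z : ℝ × ℝ, (p z.1 - p z.2) * (v z.1 - v z.2) * kernel β lam z := by
  rw [bilin, Measure.volume_eq_prod, integral_prod _ hint]
  congr 1
  refine integral_congr_ae ?_
  filter_upwards [hp, hv] with x hx hx'
  refine integral_congr_ae ?_
  filter_upwards [hp, hv] with y hy hy'
  rw [hx, hx', hy, hy', div_eq_mul_inv, kernel]

theorem stiffness_isSymm (β lam : ℝ) (r n : ℕ) : (stiffness β lam r n).IsSymm := by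
  refine Matrix.IsSymm.ext fun i j => ?_
  simp only [stiffness, Matrix.of_apply, bilin]
  congr 1
  refine integral_congr_ae (Filter.Eventually.of_forall fun x => ?_)
  refine integral_congr_ae (Filter.Eventually.of_forall fun y => ?_)
  simp only [mul_comm (phi r n j x - phi r n j y)]

theorem stiffness_apply {r : ℕ} (hr : r = 1 ∨ r = 2) {β lam : ℝ} (hβ : 0 < β) (hβr : β < r)
    (hlam : 0 ≤ lam) (n : ℕ) (i j : Fin (2 ^ n - r + 1)) :
    stiffness β lam r n i j = cConst β lam / 2 * ∫ z : ℝ × ℝ,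
      (scaledSpline r n i z.1 - scaledSpline r n i z.2) *
        (scaledSpline r n j z.1 - scaledSpline r n j z.2) * kernel β lam z :=
  bilin_eq_integral_prod (phi_ae_eq hr n i) (phi_ae_eq hr n j)
    (integrable_mul_energyDensity (measurable_scaledSpline _ _ _) (measurable_scaledSpline _ _ _)
      (integrable_energyDensity_scaledSpline hr hβ hβr hlam _ _)
      (integrable_energyDensity_scaledSpline hr hβ hβr hlam _ _))

theorem stiffness_diag {r : ℕ} (hr : r = 1 ∨ r = 2) {β lam : ℝ} (hβ : 0 < β) (hβr : β < r)
    (hlam : 0 ≤ lam) (n : ℕ) (i : Fin (2 ^ n - r + 1)) :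
    stiffness β lam r n i i = cConst β lam / 2 * energy β lam (scaledSpline r n i) := by
  rw [stiffness_apply hr hβ hβr hlam, energy]
  simp only [← sq]

theorem energyDensity_sum (r n : ℕ) {N : ℕ} (c : Fin N → ℝ) (β lam : ℝ) (z : ℝ × ℝ) :
    ((∑ j, c j * scaledSpline r n j z.1) - ∑ j, c j * scaledSpline r n j z.2) ^ 2 *
        kernel β lam z
      = ∑ i, ∑ j, c i * c j * ((scaledSpline r n i z.1 - scaledSpline r n i z.2) *
        (scaledSpline r n j z.1 - scaledSpline r n j z.2) * kernel β lam z) := by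
  rw [← Finset.sum_sub_distrib, sq, Finset.sum_mul_sum, Finset.sum_mul]
  refine Finset.sum_congr rfl fun i _ => ?_
  rw [Finset.sum_mul]
  exact Finset.sum_congr rfl fun j _ => by ring

/-! ### Two-sided bounds for the quadratic form -/

section QuadraticForm

variable {r : ℕ} {β lam : ℝ}

theorem integrable_mul_scaledSpline (hr : r = 1 ∨ r = 2) (hβ : 0 < β) (hβr : β < r)
    (hlam : 0 ≤ lam) (n i j : ℕ) :
    Integrable fun z : ℝ × ℝ => (scaledSpline r n i z.1 - scaledSpline r n i z.2) *
        (scaledSpline r n j z.1 - scaledSpline r n j z.2) * kernel β lam z :=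
  integrable_mul_energyDensity (measurable_scaledSpline _ _ _) (measurable_scaledSpline _ _ _)
    (integrable_energyDensity_scaledSpline hr hβ hβr hlam _ _)
    (integrable_energyDensity_scaledSpline hr hβ hβr hlam _ _)

theorem integrable_energyDensity_sum (hr : r = 1 ∨ r = 2) (hβ : 0 < β) (hβr : β < r)
    (hlam : 0 ≤ lam) (n : ℕ) {N : ℕ} (c : Fin N → ℝ) :
    Integrable fun z : ℝ × ℝ => ((∑ j, c j * scaledSpline r n j z.1)
      - ∑ j, c j * scaledSpline r n j z.2) ^ 2 * kernel β lam z := by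
  simp only [energyDensity_sum]
  exact integrable_finsetSum _ fun i _ => integrable_finsetSum _ fun j _ =>
    (integrable_mul_scaledSpline hr hβ hβr hlam n i j).const_mul _

open Matrix in
theorem dotProduct_stiffness_mulVec (hr : r = 1 ∨ r = 2) (hβ : 0 < β) (hβr : β < r)
    (hlam : 0 ≤ lam) (n : ℕ) (c : Fin (2 ^ n - r + 1) → ℝ) :
    c ⬝ᵥ stiffness β lam r n *ᵥ c
      = cConst β lam / 2 * energy β lam fun x => ∑ j, c j * scaledSpline r n j x := by
  have hint := fun i j : Fin (2 ^ n - r + 1) => integrable_mul_scaledSpline hr hβ hβr hlam n i j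
  rw [energy]
  simp only [energyDensity_sum]
  rw [integral_finsetSum _ fun i _ => integrable_finsetSum _ fun j _ => (hint i j).const_mul _,
    Finset.mul_sum, dotProduct]
  refine Finset.sum_congr rfl fun i _ => ?_
  rw [integral_finsetSum _ fun j _ => (hint i j).const_mul _, Finset.mul_sum, mulVec, dotProduct,
    Finset.mul_sum]
  refine Finset.sum_congr rfl fun j _ => ?_
  rw [integral_const_mul, stiffness_apply hr hβ hβr hlam]
  ring

theorem energy_sum_le (hr : r = 1 ∨ r = 2) (hβ : 0 < β) (hβr : β < r)
    (hlam : 0 ≤ lam) (n : ℕ) {N : ℕ} (c : Fin N → ℝ) :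
    (energy β lam fun x => ∑ j, c j * scaledSpline r n j x)
      ≤ 4 * ((2 : ℝ) ^ ((n : ℝ) * β) * energy β 0 (spline r)) * ∑ j, c j ^ 2 := by
  have hint := fun j : Fin N => integrable_energyDensity_scaledSpline hr hβ hβr hlam n j
  have hle : ∀ j : ℕ, energy β lam (scaledSpline r n j)
      ≤ (2 : ℝ) ^ ((n : ℝ) * β) * energy β 0 (spline r) := fun j => by
    rw [energy_scaledSpline]
    refine mul_le_mul_of_nonneg_left ?_ (by positivity)
    -- Dropping the level-dependent tempering lam/2^n makes the bound uniform in n.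
    exact energy_anti (measurable_spline r) (by positivity)
      (integrable_energyDensity_spline hr hβ hβr le_rfl)
  calc _ ≤ ∫ z : ℝ × ℝ, 4 * ∑ j, c j ^ 2 *
        ((scaledSpline r n j z.1 - scaledSpline r n j z.2) ^ 2 * kernel β lam z) := by
        refine integral_mono (integrable_energyDensity_sum hr hβ hβr hlam n c)
          ((integrable_finsetSum _ fun j _ => (hint j).const_mul _).const_mul _) fun z => ?_
        have := mul_le_mul_of_nonneg_right (sq_sum_scaledSpline_sub_le hr n c z.1 z.2)
          (kernel_nonneg β lam z)
        simp only [mul_sub, Finset.sum_sub_distrib] at this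
        refine this.trans_eq ?_
        rw [mul_assoc, Finset.sum_mul]
        congr 1
        exact Finset.sum_congr rfl fun j _ => by ring
    _ = 4 * ∑ j : Fin N, c j ^ 2 * energy β lam (scaledSpline r n j) := by
        rw [integral_const_mul, integral_finsetSum _ fun j _ => (hint j).const_mul _]
        simp only [integral_const_mul, energy]
    _ ≤ 4 * ∑ j : Fin N, c j ^ 2 * ((2 : ℝ) ^ ((n : ℝ) * β) * energy β 0 (spline r)) := by
        gcongr with j _
        exact hle j
    _ = _ := by rw [← Finset.sum_mul]; ring

theorem le_energy_sum (hr : r = 1 ∨ r = 2) (hβ : 0 < β) (hβr : β < r)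
    (hlam : 0 ≤ lam) {n : ℕ} (hn : r ≤ 2 ^ n) (c : Fin (2 ^ n - r + 1) → ℝ) :
    (Real.exp (lam * 3) * 3 ^ (1 + β))⁻¹ / 4 * ∑ j, c j ^ 2
      ≤ energy β lam fun x => ∑ j, c j * scaledSpline r n j x := by
  refine le_trans ?_ (le_energy hβ hlam
    (Finset.measurable_sum _ fun j _ => (measurable_scaledSpline r n j).const_mul _)
    (C := ∑ j, |c j| * (2 : ℝ) ^ ((n : ℝ) / 2)) (fun x => ?_) (fun x hx => ?_)
    (integrable_energyDensity_sum hr hβ hβr hlam n c))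
  · rw [div_mul_eq_mul_div, mul_div_assoc]
    exact mul_le_mul_of_nonneg_left (sum_sq_div_four_le_integral hr hn c) (by positivity)
  · refine (Finset.abs_sum_le_sum_abs _ _).trans (Finset.sum_le_sum fun j _ => ?_)
    rw [abs_mul]
    exact mul_le_mul_of_nonneg_left (abs_scaledSpline_le _ _ _ _) (abs_nonneg _)
  · refine Finset.sum_eq_zero fun j _ => ?_
    rw [scaledSpline_eq_zero hr hn j.2 (Or.inr (by linarith)), mul_zero]

/-- A coefficient vector with norm bounded below whose spline has energy independent of the level. -/
theorem exists_dotProduct_stiffness_le (hr : r = 1 ∨ r = 2) (hβ : 0 < β) (hβr : β < r)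
    (hlam : 0 ≤ lam) {n : ℕ} (hn : r ≤ 2 ^ n) :
    ∃ c : Fin (2 ^ n - r + 1) → ℝ, 1 / 16 ≤ c ⬝ᵥ c ∧
      c ⬝ᵥ (stiffness β lam r n).mulVec c
        = cConst β lam / 2 * energy β lam (scaledSpline r (r - 1) 0) := by
  obtain ⟨c, hc⟩ := exists_sum_scaledSpline_eq hr hn
  refine ⟨c, ?_, ?_⟩
  · have h1 := integral_sum_scaledSpline_sq_le hr n c
    simp only [hc] at h1
    have hr' : r ≤ 2 ^ (r - 1) := by rcases hr with rfl | rfl <;> norm_num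
    -- Level r - 1 has exactly one basis function. Stability there gives 1/4 ≤ ∫u², and the upper
    -- bound at level n gives ∫u² ≤ 4 (c ⬝ᵥ c), hence 1/16.
    have h2 := sum_sq_div_four_le_integral hr hr' (Pi.single 0 1)
    rw [Fintype.sum_eq_single (0 : Fin (2 ^ (r - 1) - r + 1)) fun j hj => by simp [hj]] at h2
    have h3 : ∀ x, ∑ j : Fin (2 ^ (r - 1) - r + 1),
        (Pi.single 0 1 : Fin (2 ^ (r - 1) - r + 1) → ℝ) j * scaledSpline r (r - 1) j x
          = scaledSpline r (r - 1) 0 x := fun x => by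
      rw [Fintype.sum_eq_single (0 : Fin (2 ^ (r - 1) - r + 1)) fun j hj => by simp [hj]]
      simp
    simp only [h3, Pi.single_eq_same] at h2
    simp only [dotProduct, ← sq]
    linarith
  · rw [dotProduct_stiffness_mulVec hr hβ hβr hlam]
    simp only [hc]

end QuadraticForm

end TemperedLaplacian

end

/-! ### The condition number -/

/-- For every order `r`, exponent `β` and tempering parameter `lam`, the stiffness matrices on the
levels `n` with `2 ^ n ≥ 2 * r` are symmetric positive definite, and their spectral condition
numbers are comparable to `2 ^ (n * β)`, uniformly in `n`. -/
theorem proposition5p2 (r : ℕ) (β lam : ℝ) (hβ : 0 < β)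
    (hr : (r = 1 ∧ β < 1) ∨ (r = 2 ∧ β < 2)) (hlam : 0 ≤ lam) :
    ∃ c C : ℝ, 0 < c ∧ 0 < C ∧ ∀ n : ℕ, 2 * r ≤ 2 ^ n →
      (TemperedLaplacian.stiffness β lam r n).PosDef ∧
      c * (2 : ℝ) ^ ((n : ℝ) * β)
        ≤ TemperedLaplacian.cond2 (TemperedLaplacian.stiffness β lam r n) ∧
      TemperedLaplacian.cond2 (TemperedLaplacian.stiffness β lam r n)
        ≤ C * (2 : ℝ) ^ ((n : ℝ) * β) := by
  open TemperedLaplacian in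
  have hβr : β < r := by
    rcases hr with ⟨rfl, h⟩ | ⟨rfl, h⟩
    · simpa using h
    · simpa using h
  have hβ2 : β < 2 := by rcases hr with ⟨_, h⟩ | ⟨_, h⟩ <;> linarith
  replace hr : r = 1 ∨ r = 2 := hr.imp And.left And.left
  have hc := cConst_pos hβ hβ2 lam
  have hE := energy_spline_pos hr hβ hβr hlam
  have hE0 := energy_spline_pos hr hβ hβr le_rfl
  set κ := cConst β lam / 2 with hκ
  have hκ0 : 0 < κ := by positivity
  set E := energy β lam (spline r)
  set E0 := energy β 0 (spline r)
  set G := energy β lam (scaledSpline r (r - 1) 0) with hG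
  have hG0 : 0 < G := by
    rw [hG, energy_scaledSpline]
    exact mul_pos (by positivity) (energy_spline_pos hr hβ hβr (by positivity))
  set m := κ * ((Real.exp (lam * 3) * 3 ^ (1 + β))⁻¹ / 4) with hm
  have hm0 : 0 < m := by positivity
  -- Lower constant: a diagonal entry times the test-vector bound for ‖A⁻¹‖. Upper constant: the
  -- overlap bound for ‖A‖ times the inverse coercivity constant.
  refine ⟨κ * E * (16 * (κ * G))⁻¹, κ * (4 * E0) * m⁻¹, by positivity, by positivity,
    fun n hn => ?_⟩
  have hn' : r ≤ 2 ^ n := by omega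
  set P := (2 : ℝ) ^ ((n : ℝ) * β) with hP
  have hP0 : 0 < P := by positivity
  have hsymm := stiffness_isSymm β lam r n
  have hlow : ∀ x : Fin (2 ^ n - r + 1) → ℝ,
      m * (x ⬝ᵥ x) ≤ x ⬝ᵥ (stiffness β lam r n).mulVec x := fun x => by
    rw [dotProduct_stiffness_mulVec hr hβ hβr hlam, hm, mul_assoc]
    refine mul_le_mul_of_nonneg_left ?_ hκ0.le
    have := le_energy_sum hr hβ hβr hlam hn' x
    simpa only [dotProduct, ← sq] using this
  have hupp : ∀ x : Fin (2 ^ n - r + 1) → ℝ,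
      x ⬝ᵥ (stiffness β lam r n).mulVec x ≤ κ * (4 * (P * E0)) * (x ⬝ᵥ x) := fun x => by
    rw [dotProduct_stiffness_mulVec hr hβ hβr hlam, mul_assoc]
    refine mul_le_mul_of_nonneg_left ?_ hκ0.le
    have := energy_sum_le hr hβ hβr hlam n x
    simpa only [dotProduct, ← sq] using this
  have hpd : (stiffness β lam r n).PosDef := posDef_of_le_dotProduct hsymm hm0 hlow
  have hxx : ∀ x : Fin (2 ^ n - r + 1) → ℝ, 0 ≤ x ⬝ᵥ x := fun x =>
    Finset.sum_nonneg fun i _ => mul_self_nonneg _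
  have hdiag : κ * (P * E) ≤ specNorm (stiffness β lam r n) := by
    refine le_trans ?_ (diag_le_specNorm _ 0)
    rw [stiffness_diag hr hβ hβr hlam, energy_scaledSpline]
    refine mul_le_mul_of_nonneg_left (mul_le_mul_of_nonneg_left ?_ hP0.le) hκ0.le
    -- Since lam/2^n ≤ lam, the rescaled energy is at least E, uniformly in n.
    exact energy_anti (measurable_spline r) (div_le_self hlam (one_le_pow₀ one_le_two))
      (integrable_energyDensity_spline hr hβ hβr (by positivity))
  refine ⟨hpd, ?_, ?_⟩
  · obtain ⟨x, hx1, hx2⟩ := exists_dotProduct_stiffness_le hr hβ hβr hlam hn'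
    have hinv : (16 * (κ * G))⁻¹ ≤ specNorm (stiffness β lam r n)⁻¹ := by
      refine inv_le_specNorm_inv hpd (by positivity) (by linarith) (x := x) ?_
      rw [hx2]
      nlinarith [mul_pos hκ0 hG0]
    calc κ * E * (16 * (κ * G))⁻¹ * P = κ * (P * E) * (16 * (κ * G))⁻¹ := by ring
      _ ≤ cond2 (stiffness β lam r n) :=
        mul_le_mul hdiag hinv (by positivity) (le_trans (by positivity) hdiag)
  · calc cond2 (stiffness β lam r n) ≤ κ * (4 * (P * E0)) * m⁻¹ := by
          refine mul_le_mul ?_ (specNorm_inv_le hpd hm0 hlow) (norm_nonneg _) (by positivity)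
          exact specNorm_le_of_dotProduct_le hsymm (by positivity)
            (fun x => (mul_nonneg hm0.le (hxx x)).trans (hlow x)) hupp
      _ = κ * (4 * E0) * m⁻¹ * P := by ring
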